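/- Let $\Omega_1,\Omega_2\subset\mathbb C^n$ be bounded domains and let $dV$ be Lebesgue measure. Let $K_1$ be the Bergman kernel of $\Omega_1$, i.e. the reproducing kernel of the space $A^2(\Omega_1)$ of square-integrable holomorphic functions, and put $P(z,\xi)=|K_1(z,\xi)|^2/K_1(z,z)$ and $\Phi_1(z)=P(z,\xi)\,dV(\xi)$ for $z,\xi\in\Omega_1$. Let $M_1=\Phi_1(\Omega_1)$, with tangent space at $\mu=\Phi_1(z)$ given by $T_\mu M_1=\{(\partial_vP)(z,\xi)\,dV(\xi): v\in\mathbb C^n\cong\mathbb R^{2n}\}$, where $\partial_v$ is the real directional derivative in $z$. The Fisher metric is $g_F(\mu)(\sigma_1,\sigma_2)=\int\frac{d\sigma_1}{d\mu}\frac{d\sigma_2}{d\mu}\,d\mu$ (with Radon–Nikodym derivatives). A measurable map $f:\Omega_1\to\Omega_2$ with push-forward $\kappa=f_*$ is called sufficient if $g_F(\kappa\mu)(\kappa\sigma,\kappa\sigma)=g_F(\mu)(\sigma,\sigma)$ for all $\mu\in M_1$ and $\sigma\in T_\mu M_1$. Theorem B. Let $f:\Omega_1\to\Omega_2$ be a surjective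 measurable map, and suppose that for some integer $m\ge1$ and some null set $V\subset\Omega_2$ the map $f:f^{-1}(\Omega_2\setminus V)\to\Omega_2\setminus V$ is an $m$-sheeted $C^1$-smooth covering map, i.e. every $\zeta\in\Omega_2\setminus V$ has an open neighbourhood in $\Omega_2$ whose preimage is a disjoint union of $m$ open sets, each mapped by $f$ $C^1$-diffeomorphically onto that neighbourhood. Then $f$ is injective up to a null set (i.e. injective on $\Omega_1\setminus N$ for some null set $N\subset\Omega_1$) if and only if $f$ is sufficient. In particular $f$ is sufficient if it is injective. If $f$ is sufficient, then $f$ is injective on all of $f^{-1}(\Omega_2\setminus V)$ (that is, $m=1$). If $f$ is moreover an open map (for example, a covering map, or a proper holomorphic map), then $f$ is injective on $\Omega_1$ if and only if $f$ is sufficient. -/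

import Mathlib

open MeasureTheory

attribute [local instance] Measure.Subtype.measureSpace

noncomputable section

/-! ### Statistical models and the Fisher information metric -/

/-- The Fisher information metric at `μ`, `g_F(μ)(σ₁, σ₂) = ∫ (dσ₁/dμ) (dσ₂/dμ) dμ`, where
`dσ/dμ` is the Radon-Nikodym derivative of the signed measure `σ`. -/
def fisherMetric {X : Type*} [MeasurableSpace X] (μ : Measure X) (σ₁ σ₂ : SignedMeasure X) : ℝ :=
  ∫ ξ, σ₁.rnDeriv μ ξ * σ₂.rnDeriv μ ξ ∂μ

/-- The member `P(x, ξ) dV(ξ)` of the family with densities `P(x, ·)`. -/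
def densityMeasure {E X : Type*} [MeasureSpace X] (P : E → X → ℝ) (x : E) : Measure X :=
  volume.withDensity (fun ξ => ENNReal.ofReal (P x ξ))

/-- The velocity `(∂_v P)(x, ξ) dV(ξ)` of the family `x ↦ P(x, ξ) dV(ξ)` in the (real) direction
`v` of the parameter space. -/
def densityTangent {E X : Type*} [NormedAddCommGroup E] [NormedSpace ℝ E] [MeasureSpace X]
    (P : E → X → ℝ) (x v : E) : SignedMeasure X :=
  volume.withDensityᵥ (fun ξ => fderiv ℝ (fun y => P y ξ) x v)

/-- The statistical model `M = { P(x, ξ) dV(ξ) : x ∈ Ω }` with parameter space `Ω`. -/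
def statModel {E X : Type*} [MeasureSpace X] (Ω : Set E) (P : E → X → ℝ) : Set (Measure X) :=
  densityMeasure P '' Ω

/-- The tangent space `T_μ M` of the model. -/
def statTangentSpace {E X : Type*} [NormedAddCommGroup E] [NormedSpace ℝ E] [MeasureSpace X]
    (Ω : Set E) (P : E → X → ℝ) (μ : Measure X) : Set (SignedMeasure X) :=
  {σ | ∃ x ∈ Ω, densityMeasure P x = μ ∧ ∃ v : E, σ = densityTangent P x v}

/-- A statistic `f : X → Y` is sufficient for the model `M` if the push-forward `κ = f_*`
satisfies `g_F(κ μ)(κ σ, κ σ) = g_F(μ)(σ, σ)` for all `μ ∈ M` and `σ ∈ T_μ M`. -/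
def IsSufficient {E X Y : Type*} [NormedAddCommGroup E] [NormedSpace ℝ E] [MeasureSpace X]
    [MeasurableSpace Y] (f : X → Y) (Ω : Set E) (P : E → X → ℝ) : Prop :=
  ∀ μ ∈ statModel Ω P, ∀ σ ∈ statTangentSpace Ω P μ,
    fisherMetric (μ.map f) (σ.map f) (σ.map f) = fisherMetric μ σ σ

/-! ### The Bergman kernel -/

/-- `h` belongs to the Bergman space `A²(Ω)`: it is holomorphic and square integrable on `Ω`. -/
def MemBergmanSpace {n : ℕ} (Ω : Set (Fin n → ℂ)) (h : (Fin n → ℂ) → ℂ) : Prop :=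
  DifferentiableOn ℂ h Ω ∧ MemLp h 2 (volume.restrict Ω)

/-- `k ∈ A²(Ω)` represents the evaluation at `w`: `h(w) = ⟨h, k⟩` for all `h ∈ A²(Ω)`. -/
def IsReproducingAt {n : ℕ} (Ω : Set (Fin n → ℂ)) (w : Fin n → ℂ) (k : (Fin n → ℂ) → ℂ) : Prop :=
  MemBergmanSpace Ω k ∧
    ∀ h, MemBergmanSpace Ω h → h w = ∫ ξ in Ω, h ξ * (starRingEnd ℂ) (k ξ)

open Classical in
/-- The Bergman kernel `K(z, w)` of `Ω`: the reproducing kernel of `A²(Ω)`. For `w ∈ Ω` the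
function `K(·, w)` is, on `Ω`, the unique element of `A²(Ω)` that represents evaluation at `w`
(it exists by the Riesz representation theorem). -/
def bergmanKernel {n : ℕ} (Ω : Set (Fin n → ℂ)) (z w : Fin n → ℂ) : ℂ :=
  if h : ∃ k, IsReproducingAt Ω w k then h.choose z else 0

/-- The Poisson-Bergman (Berezin) kernel `P(z, ξ) = |K(z, ξ)|² / K(z, z)`, `ξ ∈ Ω`. The density of
`Φ(z) = P(z, ξ) dV(ξ)`. -/
def poissonBergman {n : ℕ} (Ω : Set (Fin n → ℂ)) (z : Fin n → ℂ) (ξ : Ω) : ℝ :=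
  ‖bergmanKernel Ω z ξ‖ ^ 2 / (bergmanKernel Ω z z).re

/-! ### Coverings off a null set -/

/-- Over `Ω₂ \ V` the map `f : Ω₁ → Ω₂` is an `m`-sheeted `C¹`-smooth covering map: every
`ζ ∈ Ω₂ \ V` has an open neighbourhood `U` whose preimage is the disjoint union of `m` open sets,
each mapped by `f` onto `U` by a `C¹`-diffeomorphism. -/
def IsSheetedC1CoveringOff {n : ℕ} {Ω₁ Ω₂ : Set (Fin n → ℂ)} (f : Ω₁ → Ω₂) (V : Set Ω₂)
    (m : ℕ) : Prop :=
  ∀ ζ : Ω₂, ζ ∉ V → ∃ U : Set (Fin n → ℂ), IsOpen U ∧ (ζ : Fin n → ℂ) ∈ U ∧ U ⊆ Ω₂ ∧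
    ∃ e : Fin m → OpenPartialHomeomorph (Fin n → ℂ) (Fin n → ℂ),
      (∀ k, (e k).source ⊆ Ω₁ ∧ (e k).target = U ∧
        ContDiffOn ℝ 1 (e k) (e k).source ∧ ContDiffOn ℝ 1 (e k).symm U ∧
        ∀ x : Ω₁, (x : Fin n → ℂ) ∈ (e k).source → (f x : Fin n → ℂ) = e k x) ∧
      (∀ j k, j ≠ k → Disjoint (e j).source (e k).source) ∧
      ∀ x : Ω₁, (f x : Fin n → ℂ) ∈ U ↔ ∃ k, (x : Fin n → ℂ) ∈ (e k).source

end

noncomputable section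

/-! ### Push-forward of signed measures with densities -/

section Statistic

variable {X Y : Type*} [mX : MeasurableSpace X] [mY : MeasurableSpace Y]

/-! Push-forward by `f` replaces the score `l = ∂_v log P(z, ·)` by its conditional expectation
given `f`, and the loss in squared Fisher norm is the integral of the conditional variance. So `f`
is sufficient exactly when every score is almost everywhere a function of `f`
(`isSufficient_poissonBergman_iff`). If `f` is injective off a null set, every measurable function
has this property, by Lusin–Souslin.

Conversely, the score is `2 Re (∂_v K(z, ξ) / K(z, ξ))` minus a term independent of `ξ`. Suppose the
scores factor through `f`, and use a countable dense set of pairs `(z, v)`. Off one null set, `f x =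
f y` then forces equal real logarithmic derivatives of `K(·, x)` and `K(·, y)`. Using both `v` and
`iv`, and the identity theorem, `K(·, x) = c K(·, y)`. Pairing with `1` and the coordinate
functions, which lie in `A²` because the domain is bounded, gives `x = y`.

Two sheets of the covering would produce a positive-measure set of double points, and an open map
would spread one double point over an open set; both contradict injectivity off a null set.

The analytic input is that point evaluation is holomorphic in `z` for the dual norm
(`differentiableOn_bergmanEval`). This yields completeness of `A²`, the kernel, differentiability of
`P`, and square integrability of the scores. -/

theorem rnDeriv_map_withDensityᵥ_comp {μ : Measure X} [IsFiniteMeasure μ] {f : X → Y}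
    (hf : Measurable f) {l : X → ℝ} (hl : Integrable l μ) :
    (fun x => SignedMeasure.rnDeriv ((μ.withDensityᵥ l).map f) (μ.map f) (f x)) =ᵐ[μ]
      μ[l | mY.comap f] := by
  have hm : mY.comap f ≤ mX := hf.comap_le
  -- The conditional expectation is measurable for the pulled-back σ-algebra, hence of the form `h ∘
  -- f`; its defining property says that `h` is the density of the pushed-forward signed measure.
  obtain ⟨h, hh, he⟩ :=
    (stronglyMeasurable_condExp (μ := μ) (m := mY.comap f) (f := l)).exists_eq_measurable_comp
  have hint : Integrable (h ∘ f) μ := he ▸ integrable_condExp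
  have hint' : Integrable h (μ.map f) :=
    (integrable_map_measure hh.aestronglyMeasurable hf.aemeasurable).2 hint
  have key : (μ.withDensityᵥ l).map f = 0 + (μ.map f).withDensityᵥ h := by
    rw [zero_add]
    ext s hs
    rw [VectorMeasure.map_apply _ hf hs, withDensityᵥ_apply hl (hf hs),
      withDensityᵥ_apply hint' hs, setIntegral_map hs hh.aestronglyMeasurable hf.aemeasurable,
      ← setIntegral_condExp hm hl ⟨s, hs, rfl⟩, he]
    rfl
  have := SignedMeasure.eq_rnDeriv (μ := μ.map f) 0 h hint' VectorMeasure.MutuallySingular.zero_left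
    key
  have h2 := ae_of_ae_map hf.aemeasurable this
  rw [he]
  filter_upwards [h2] with x hx
  exact hx.symm

theorem rnDeriv_withDensityᵥ {μ : Measure X} {l : X → ℝ} (hl : Integrable l μ) :
    SignedMeasure.rnDeriv (μ.withDensityᵥ l) μ =ᵐ[μ] l :=
  (SignedMeasure.eq_rnDeriv 0 l hl VectorMeasure.MutuallySingular.zero_left
    (zero_add _).symm).symm

/-- The push-forward by `f` preserves the Fisher norm of `l dμ` if and only if the logarithmic
derivative `l` factors through `f`. -/
theorem fisherMetric_map_eq_iff {μ : Measure X} [IsFiniteMeasure μ] {f : X → Y}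
    (hf : Measurable f) {l : X → ℝ} (hl : MemLp l 2 μ) :
    fisherMetric (μ.map f) ((μ.withDensityᵥ l).map f) ((μ.withDensityᵥ l).map f) =
        fisherMetric μ (μ.withDensityᵥ l) (μ.withDensityᵥ l) ↔
      ∃ G : Y → ℝ, Measurable G ∧ l =ᵐ[μ] G ∘ f := by
  have hl1 : Integrable l μ := hl.integrable one_le_two
  have hm : mY.comap f ≤ mX := hf.comap_le
  set G := SignedMeasure.rnDeriv ((μ.withDensityᵥ l).map f) (μ.map f) with hG
  have hGm : Measurable G := SignedMeasure.measurable_rnDeriv _ _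
  have hGc : G ∘ f =ᵐ[μ] μ[l | mY.comap f] := rnDeriv_map_withDensityᵥ_comp hf hl1
  have hc2 : MemLp (μ[l | mY.comap f]) 2 μ := hl.condExp one_le_two
  have e1 : fisherMetric (μ.map f) ((μ.withDensityᵥ l).map f) ((μ.withDensityᵥ l).map f) =
      ∫ x, (μ[l | mY.comap f]) x ^ 2 ∂μ := by
    rw [fisherMetric, ← hG,
      integral_map (f := fun y => G y * G y) hf.aemeasurable (hGm.mul hGm).aestronglyMeasurable]
    refine integral_congr_ae ?_
    filter_upwards [hGc] with x hx
    rw [← hx, sq]; rfl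
  have e2 : fisherMetric μ (μ.withDensityᵥ l) (μ.withDensityᵥ l) = ∫ x, l x ^ 2 ∂μ := by
    refine integral_congr_ae ?_
    filter_upwards [rnDeriv_withDensityᵥ hl1] with x hx
    rw [hx, sq]
  -- Pythagoras for conditional expectation: equal Fisher norms force `l = μ[l | f]` almost
  -- everywhere.
  have e3 : ∫ x, (l x - (μ[l | mY.comap f]) x) ^ 2 ∂μ = ∫ x, l x ^ 2 ∂μ - ∫ x, (μ[l | mY.comap f]) x ^ 2 ∂μ := by
    have h1 : ∫ x, (ProbabilityTheory.condVar (mY.comap f) l μ) x ∂μ = ∫ x, (l x - (μ[l | mY.comap f]) x) ^ 2 ∂μ :=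
      integral_condExp hm
    rw [← h1, integral_congr_ae (ProbabilityTheory.condVar_ae_eq_condExp_sq_sub_sq_condExp hm hl),
      integral_sub' (f := μ[l ^ 2 | mY.comap f]) (g := μ[l | mY.comap f] ^ 2)
        integrable_condExp hc2.integrable_sq, integral_condExp hm]
    rfl
  rw [e1, e2]
  constructor
  · intro h
    refine ⟨G, hGm, ?_⟩
    rw [h, sub_self] at e3
    have e3 := (integral_eq_zero_iff_of_nonneg (fun x => sq_nonneg _)
      (hl.sub hc2).integrable_sq).1 e3
    filter_upwards [e3, hGc] with x hx hx'
    rw [hx']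
    have : l x - (μ[l | mY.comap f]) x = 0 := by simpa using hx
    linarith
  · rintro ⟨H, hH, hlH⟩
    have : μ[l | mY.comap f] =ᵐ[μ] l := by
      refine (condExp_congr_ae hlH).trans ?_
      rw [condExp_of_stronglyMeasurable hm
        ((hH.comp (comap_measurable f)).stronglyMeasurable) (hl1.congr hlH)]
      exact hlH.symm
    refine integral_congr_ae ?_
    filter_upwards [this] with x hx
    rw [hx]

/-- A map that is injective off a null set has an almost everywhere left inverse, hence every
measurable function factors through it almost everywhere. -/
theorem exists_measurable_factor_of_injOn [StandardBorelSpace X]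
    [MeasurableSpace.CountablySeparated Y] {ν : Measure X} {f : X → Y}
    (hf : Measurable f) {N : Set X} (hN : ν N = 0) (hinj : Set.InjOn f Nᶜ) {l : X → ℝ}
    (hl : AEMeasurable l ν) : ∃ G : Y → ℝ, Measurable G ∧ l =ᵐ[ν] G ∘ f := by
  set A : Set X := (toMeasurable ν N)ᶜ with hA
  have hAm : MeasurableSet A := (measurableSet_toMeasurable ν N).compl
  have hAN : A ⊆ Nᶜ := Set.compl_subset_compl.2 (subset_toMeasurable ν N)
  have : StandardBorelSpace A := hAm.standardBorel
  -- Lusin–Souslin: an injective measurable map on a standard Borel space is a measurable embedding.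
  have hfA : MeasurableEmbedding (fun x : A => f x) :=
    (hf.comp measurable_subtype_coe).measurableEmbedding fun x y h =>
      Subtype.ext (hinj (hAN x.2) (hAN y.2) h)
  obtain ⟨G, hG, he⟩ := hfA.exists_measurable_extend
    (g := fun x : A => hl.mk l x) (hl.measurable_mk.comp measurable_subtype_coe) fun _ => ⟨0⟩
  refine ⟨G, hG, ?_⟩
  have hAae : ∀ᵐ x ∂ν, x ∈ A := by
    rw [ae_iff]
    simpa [hA, measure_toMeasurable] using hN
  filter_upwards [hAae, hl.ae_eq_mk] with x hx hx'
  have := congrFun he ⟨x, hx⟩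
  simp only [Function.comp] at this ⊢
  rw [this, hx']

end Statistic

/-! ### Holomorphic functions of several variables -/

section SeveralVariables

open Metric Set Filter Topology

variable {E F : Type*} [NormedAddCommGroup E] [NormedSpace ℂ E] [NormedAddCommGroup F]
  [NormedSpace ℂ F]

/-- A Schwarz-lemma form of Cauchy's estimate; the factor 2 comes from recentring the target ball at
`h c`. -/
theorem norm_fderiv_le_of_forall_mem_ball {h : E → F} {c : E} {R M : ℝ} (hR : 0 < R)
    (hd : DifferentiableOn ℂ h (ball c R)) (hM : ∀ y ∈ ball c R, ‖h y‖ ≤ M) :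
    ‖fderiv ℂ h c‖ ≤ 2 * M / R := by
  refine Complex.norm_fderiv_le_div_of_mapsTo_ball hd (fun y hy => ?_) hR
  rw [mem_closedBall, dist_eq_norm]
  calc ‖h y - h c‖ ≤ ‖h y‖ + ‖h c‖ := norm_sub_le _ _
    _ ≤ 2 * M := by linarith [hM y hy, hM c (mem_ball_self hR)]

/-- Removing the linear part leaves a function with second-order contact at `c`, so the higher-order
Schwarz lemma gives quadratic decay. The bound `4 * M` is `M + 2M + M`. -/
theorem norm_sub_sub_fderiv_le_of_forall_mem_ball {h : E → F} {c : E} {R M : ℝ} (hR : 0 < R)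
    (hd : DifferentiableOn ℂ h (ball c R)) (hM : ∀ y ∈ ball c R, ‖h y‖ ≤ M) {z : E}
    (hz : z ∈ ball c R) :
    ‖h z - h c - fderiv ℂ h c (z - c)‖ ≤ 4 * M * (‖z - c‖ / R) ^ 2 := by
  set g : E → F := fun y => h y - fderiv ℂ h c (y - c) with hg
  have hgc : g c = h c := by simp [hg]
  have hgd : DifferentiableOn ℂ g (ball c R) :=
    hd.sub ((fderiv ℂ h c).differentiable.comp (differentiable_id.sub_const c)).differentiableOn
  have hb := norm_fderiv_le_of_forall_mem_ball hR hd hM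
  have key := Complex.dist_le_mul_div_pow_of_mapsTo_ball_of_isLittleO (n := 1) (R₂ := 4 * M)
    hgd (fun y hy => ?_) ?_ hz
  · rw [dist_eq_norm, dist_eq_norm, hgc] at key
    have e : h z - h c - fderiv ℂ h c (z - c) = g z - h c := sub_right_comm _ _ _
    rw [e]
    exact key
  · rw [mem_closedBall, dist_eq_norm, hgc]
    have h1 : ‖fderiv ℂ h c (y - c)‖ ≤ 2 * M / R * R := by
      refine ((fderiv ℂ h c).le_opNorm _).trans ?_
      have h2 : ‖y - c‖ ≤ R := by rw [← dist_eq_norm]; exact (mem_ball.1 hy).le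
      have h3 : 0 ≤ ‖y - c‖ := norm_nonneg _
      have h4 : 0 ≤ ‖fderiv ℂ h c‖ := norm_nonneg _
      exact mul_le_mul hb h2 h3 (h4.trans hb)
    rw [div_mul_cancel₀ _ hR.ne'] at h1
    calc ‖g y - h c‖ = ‖h y - fderiv ℂ h c (y - c) - h c‖ := rfl
      _ ≤ ‖h y‖ + ‖fderiv ℂ h c (y - c)‖ + ‖h c‖ :=
        (norm_sub_le _ _).trans (add_le_add_left (norm_sub_le _ _) _)
      _ ≤ 4 * M := by linarith [hM y hy, hM c (mem_ball_self hR)]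
  · have := ((hd.differentiableAt (ball_mem_nhds c hR)).hasFDerivAt).isLittleO
    simp only [pow_one, hgc]
    refine (this.norm_right).congr_left fun y => ?_
    simp only [hg]; abel

theorem DifferentiableOn.continuousOn_fderiv_of_complex {h : E → F} {Ω : Set E} (hΩ : IsOpen Ω)
    (hd : DifferentiableOn ℂ h Ω) : ContinuousOn (fderiv ℂ h) Ω := by
  intro w hw
  obtain ⟨R₁, hR₁, hb₁⟩ := Metric.isOpen_iff.1 hΩ w hw
  have hcont : ContinuousAt h w := (hd.continuousOn).continuousAt (hΩ.mem_nhds hw)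
  obtain ⟨R₂, hR₂, hb₂⟩ := Metric.continuousAt_iff.1 hcont 1 one_pos
  set R := min R₁ R₂
  have hR : 0 < R := lt_min hR₁ hR₂
  have hdR : DifferentiableOn ℂ h (ball w R) :=
    hd.mono ((ball_subset_ball (min_le_left _ _)).trans hb₁)
  set M := ‖h w‖ + 1
  have hM : ∀ y ∈ ball w R, ‖h y‖ ≤ M := fun y hy => by
    have h1 := hb₂ (lt_of_lt_of_le (mem_ball.1 hy) (min_le_right _ _))
    rw [dist_eq_norm] at h1
    have := norm_sub_norm_le (h y) (h w)
    linarith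
  -- With `δ = ‖y - w‖`, the Taylor remainder at `w` is at most `16Mδ²/R²` on `ball y δ`; Cauchy's
  -- estimate there bounds its derivative by `32Mδ/R²`.
  have hlip : ∀ y ∈ ball w (R / 2), ‖fderiv ℂ h y - fderiv ℂ h w‖ ≤ 32 * M / R ^ 2 * ‖y - w‖ := by
    intro y hy
    rcases eq_or_ne y w with rfl | hne
    · simp
    set δ := ‖y - w‖ with hδ
    have hδ0 : 0 < δ := norm_pos_iff.2 (sub_ne_zero.2 hne)
    have hδR : δ < R / 2 := by rw [hδ, ← dist_eq_norm]; exact hy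
    have hsub : ∀ x ∈ ball y δ, ‖x - w‖ ≤ 2 * δ := fun x hx => by
      have : x - w = (x - y) + (y - w) := by abel
      rw [this]
      refine (norm_add_le _ _).trans ?_
      rw [mem_ball, dist_eq_norm] at hx
      linarith
    have hsub' : ball y δ ⊆ ball w R := fun x hx => by
      rw [mem_ball, dist_eq_norm]
      linarith [hsub x hx]
    set g : E → F := fun x => h x - h w - fderiv ℂ h w (x - w) with hg
    have hL : Differentiable ℂ fun x => fderiv ℂ h w (x - w) :=
      (fderiv ℂ h w).differentiable.comp (differentiable_id.sub_const w)
    have hgd : DifferentiableOn ℂ g (ball y δ) :=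
      ((hdR.mono hsub').sub_const _).sub hL.differentiableOn
    have hgM : ∀ x ∈ ball y δ, ‖g x‖ ≤ 4 * M * (2 * δ / R) ^ 2 := fun x hx => by
      refine (norm_sub_sub_fderiv_le_of_forall_mem_ball hR hdR hM (hsub' hx)).trans ?_
      have := hsub x hx
      have : 0 ≤ M := by positivity
      gcongr
    have hfd : fderiv ℂ g y = fderiv ℂ h y - fderiv ℂ h w := by
      have hy' : DifferentiableAt ℂ h y := hdR.differentiableAt
        (isOpen_ball.mem_nhds (hsub' (mem_ball_self hδ0)))
      have h1 : HasFDerivAt (fun x => fderiv ℂ h w (x - w)) (fderiv ℂ h w) y :=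
        (fderiv ℂ h w).hasFDerivAt.comp y ((hasFDerivAt_id y).sub_const w)
      exact ((hy'.hasFDerivAt.sub_const _).sub h1).fderiv
    have := norm_fderiv_le_of_forall_mem_ball hδ0 hgd hgM
    rw [hfd] at this
    refine this.trans (le_of_eq ?_)
    field_simp
    norm_num [mul_comm]
  refine ContinuousAt.continuousWithinAt ?_
  rw [ContinuousAt, tendsto_iff_norm_sub_tendsto_zero]
  have hlim : Tendsto (fun y => 32 * M / R ^ 2 * ‖y - w‖) (𝓝 w) (𝓝 0) := by
    have : Continuous fun y => 32 * M / R ^ 2 * ‖y - w‖ := by fun_prop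
    simpa using this.tendsto w
  refine squeeze_zero' (Eventually.of_forall fun _ => norm_nonneg _) ?_ hlim
  filter_upwards [ball_mem_nhds w (half_pos hR)] with y hy using hlip y hy

/-- The identity theorem for holomorphic functions on a connected open set. -/
theorem DifferentiableOn.eqOn_zero_of_eventually_eq_zero {h : E → ℂ} {Ω : Set E} (hΩ : IsOpen Ω)
    (hc : IsPreconnected Ω) (hd : DifferentiableOn ℂ h Ω) {w : E} (hw : w ∈ Ω)
    (h0 : ∀ᶠ y in 𝓝 w, h y = 0) : ∀ y ∈ Ω, h y = 0 := by
  have hsub : Ω ⊆ {x | ∀ᶠ y in 𝓝 x, h y = 0} := by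
    refine hc.subset_of_closure_inter_subset isOpen_setOfPred_eventually_nhds ⟨w, hw, h0⟩ ?_
    rintro x ⟨hx, hxΩ⟩
    obtain ⟨R, hR, hb⟩ := Metric.isOpen_iff.1 hΩ x hxΩ
    obtain ⟨y, hy, hyx⟩ := Metric.mem_closure_iff.1 hx R hR
    have hyx : y ∈ ball x R := by rwa [mem_ball']
    filter_upwards [ball_mem_nhds x hR] with p hp
    -- Restriction to the complex line through `y` and `p` reduces the claim to the one-variable
    -- identity theorem on a convex set.
    set L : ℂ → E := fun t => y + t • (p - y) with hL
    have hLd : Differentiable ℂ L := by fun_prop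
    set T := L ⁻¹' ball x R
    have hTo : IsOpen T := isOpen_ball.preimage hLd.continuous
    have hTc : Convex ℝ T := by
      intro s hs t ht a b ha hb hab
      have : L (a • s + b • t) = a • L s + b • L t := by
        simp only [hL, Complex.real_smul, smul_add, add_smul, mul_smul, Complex.coe_smul]
        have : y = a • y + b • y := by rw [← add_smul, hab, one_smul]
        nth_rewrite 1 [this]
        abel
      rw [mem_preimage, this]
      exact convex_ball x R hs ht ha hb hab
    have han : AnalyticOnNhd ℂ (h ∘ L) T :=
      ((hd.mono hb).comp hLd.differentiableOn fun t ht => ht).analyticOnNhd hTo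
    have h0T : (0 : ℂ) ∈ T := by simpa [T, hL] using hyx
    have h1T : (1 : ℂ) ∈ T := by simpa [T, hL] using hp
    have hev : (h ∘ L) =ᶠ[𝓝 0] 0 := by
      have h1 : Tendsto L (𝓝 0) (𝓝 y) := by
        have := hLd.continuous.tendsto 0
        simpa [hL] using this
      exact h1.eventually hy
    have := han.eqOn_zero_of_preconnected_of_eventuallyEq_zero hTc.isPreconnected h0T hev h1T
    simpa [hL] using this
  exact fun y hy => (hsub hy).self_of_nhds

/-- A weakly holomorphic, locally bounded family of functionals is holomorphic in norm. -/
theorem differentiableOn_of_forall_apply {S : Type*} [NormedAddCommGroup S] [NormedSpace ℂ S]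
    {Ω : Set E} {T : E → S →L[ℂ] ℂ} (hd : ∀ s, DifferentiableOn ℂ (fun y => T y s) Ω)
    (hb : ∀ w ∈ Ω, ∃ R > 0, ∃ C, ball w R ⊆ Ω ∧ ∀ y ∈ ball w R, ‖T y‖ ≤ C) :
    DifferentiableOn ℂ T Ω := by
  intro w hw
  obtain ⟨R, hR, C, hsub, hC⟩ := hb w hw
  have hdR : ∀ s, DifferentiableOn ℂ (fun y => T y s) (ball w R) := fun s => (hd s).mono hsub
  have hM : ∀ s, ∀ y ∈ ball w R, ‖T y s‖ ≤ C * ‖s‖ := fun s y hy =>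
    ((T y).le_opNorm s).trans (mul_le_mul_of_nonneg_right (hC y hy) (norm_nonneg _))
  have hda : ∀ s, DifferentiableAt ℂ (fun y => T y s) w := fun s =>
    (hdR s).differentiableAt (ball_mem_nhds w hR)
  let D : E →L[ℂ] S →L[ℂ] ℂ := LinearMap.mkContinuous₂
    (LinearMap.mk₂ ℂ (fun v s => fderiv ℂ (fun y => T y s) w v)
      (fun v v' s => by simp) (fun c v s => by simp)
      (fun v s s' => by
        have : (fun y => T y (s + s')) = (fun y => T y s) + fun y => T y s' := by
          ext y; simp
        rw [this, fderiv_add (hda s) (hda s')]; rfl)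
      (fun c v s => by
        have : (fun y => T y (c • s)) = c • fun y => T y s := by
          ext y; simp
        rw [this, fderiv_const_smul (hda s)]; rfl))
    (2 * C / R) (fun v s => by
      refine ((fderiv ℂ (fun y => T y s) w).le_opNorm v).trans ?_
      have := norm_fderiv_le_of_forall_mem_ball hR (hdR s) (hM s)
      calc _ ≤ 2 * (C * ‖s‖) / R * ‖v‖ := mul_le_mul_of_nonneg_right this (norm_nonneg _)
        _ = _ := by ring)
  have hD : ∀ v s, D v s = fderiv ℂ (fun y => T y s) w v := fun v s => rfl
  have hC0 : 0 ≤ C := (norm_nonneg _).trans (hC w (mem_ball_self hR))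
  refine HasFDerivAt.differentiableAt (f' := D) ?_ |>.differentiableWithinAt
  rw [hasFDerivAt_iff_isLittleO]
  -- The quadratic remainder bound is uniform in `‖s‖ ≤ 1`, which turns weak differentiability into
  -- differentiability in norm.
  have hO : (fun y => T y - T w - D (y - w)) =O[𝓝 w] fun y => ‖y - w‖ ^ 2 := by
    refine Asymptotics.IsBigO.of_bound (4 * C / R ^ 2) ?_
    filter_upwards [ball_mem_nhds w hR] with y hy
    refine ContinuousLinearMap.opNorm_le_bound _ (by positivity) fun s => ?_
    have := norm_sub_sub_fderiv_le_of_forall_mem_ball hR (hdR s) (hM s) hy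
    rw [← hD] at this
    refine this.trans (le_of_eq ?_)
    rw [Real.norm_of_nonneg (by positivity)]
    ring
  refine hO.trans_isLittleO ?_
  have : (fun y => ‖y - w‖ ^ 2) = fun y => ‖y - w‖ * ‖y - w‖ := by ext; ring
  rw [this]
  have h1 : (fun y : E => ‖y - w‖) =o[𝓝 w] fun _ => (1 : ℝ) := by
    rw [Asymptotics.isLittleO_one_iff]
    have : Continuous fun y => ‖y - w‖ := by fun_prop
    simpa using this.tendsto w
  simpa using! (h1.mul_isBigO (Asymptotics.isBigO_refl (fun y : E => ‖y - w‖) (𝓝 w))).trans_isBigO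
    (Asymptotics.isBigO_of_le _ fun y => by simp)

theorem measurePreserving_circle_mul {n : ℕ} (a : Circle) :
    MeasurePreserving (fun (u : Fin n → ℂ) => (a : ℂ) • u) volume volume :=
  volume_preserving_pi fun _ => (rotation a).measurePreserving

theorem setIntegral_closedBall_circle_smul {n : ℕ} (a : Circle) (r : ℝ) (g : (Fin n → ℂ) → ℂ) :
    ∫ u in closedBall 0 r, g ((a : ℂ) • u) = ∫ u in closedBall 0 r, g u := by
  have he : MeasurableEmbedding fun (u : Fin n → ℂ) => (a : ℂ) • u :=
    (Homeomorph.smulOfNeZero (a : ℂ) (Circle.coe_ne_zero a)).measurableEmbedding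
  have hpre : (fun (u : Fin n → ℂ) => (a : ℂ) • u) ⁻¹' closedBall 0 r = closedBall 0 r := by
    ext u
    rw [mem_preimage, mem_closedBall_zero_iff, mem_closedBall_zero_iff, norm_smul,
      Circle.norm_coe, one_mul]
  rw [← (measurePreserving_circle_mul a).setIntegral_preimage_emb he g, hpre]

theorem circleAverage_slice {h : E → ℂ} {R r : ℝ} {w : E}
    (hrR : r < R) (hd : DifferentiableOn ℂ h (ball w R)) {u : E} (hu : u ∈ closedBall 0 r) :
    Real.circleAverage (fun t : ℂ => h (w + t • u)) 0 1 = h w := by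
  have hu' : ‖u‖ ≤ r := by simpa using hu
  have hcd : DifferentiableOn ℂ (fun t : ℂ => h (w + t • u)) (closedBall 0 1) := by
    refine hd.comp (f := fun t : ℂ => w + t • u) (by fun_prop) fun t ht => ?_
    have ht' : ‖t‖ ≤ 1 := by simpa using ht
    rw [mem_ball, dist_eq_norm, add_sub_cancel_left, norm_smul]
    nlinarith [norm_nonneg u, norm_nonneg t]
  have := DiffContOnCl.circleAverage (f := fun t : ℂ => h (w + t • u)) (c := 0) (R := 1)
    (by rw [abs_one]; exact hcd.diffContOnCl_ball le_rfl)
  simpa using this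

/-- The mean value property of holomorphic functions on polydiscs. -/
theorem setIntegral_closedBall_eq_of_differentiableOn {n : ℕ} {h : (Fin n → ℂ) → ℂ} {R r : ℝ}
    {w : Fin n → ℂ} (hrR : r < R) (hd : DifferentiableOn ℂ h (ball w R)) :
    ∫ y in closedBall w r, h y = (volume (closedBall w r)).toReal * h w := by
  have htr : ∫ y in closedBall w r, h y = ∫ u in closedBall 0 r, h (w + u) := by
    rw [← (measurePreserving_add_left volume w).setIntegral_preimage_emb
      (measurableEmbedding_addLeft w) h, preimage_add_closedBall, sub_self]
  have hvol : volume (closedBall w r) = volume (closedBall (0 : Fin n → ℂ) r) := by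
    rw [Measure.addHaar_closedBall_center]
  have hmaps : ∀ t u, ‖t‖ = 1 → u ∈ closedBall (0 : Fin n → ℂ) r → w + (t : ℂ) • u ∈ ball w R := by
    intro t u ht hu
    have hu' : ‖u‖ ≤ r := by simpa using hu
    rw [mem_ball, dist_eq_norm, add_sub_cancel_left, norm_smul, ht, one_mul]
    linarith
  set B := closedBall (0 : Fin n → ℂ) r
  set I := Ioc (0 : ℝ) (2 * Real.pi)
  have hcont : ContinuousOn (fun p : (Fin n → ℂ) × ℝ => h (w + circleMap 0 1 p.2 • p.1))
      (B ×ˢ Icc 0 (2 * Real.pi)) := by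
    refine hd.continuousOn.comp ?_ fun p hp => hmaps _ _ (by simp) hp.1
    have := continuous_circleMap 0 1
    fun_prop
  have hint : Integrable (fun p : (Fin n → ℂ) × ℝ => h (w + circleMap 0 1 p.2 • p.1))
      ((volume.restrict B).prod (volume.restrict I)) := by
    rw [Measure.prod_restrict]
    exact (hcont.integrableOn_compact ((isCompact_closedBall _ _).prod isCompact_Icc)).mono_set
      (prod_mono_right Ioc_subset_Icc_self)
  have h2pi : (0 : ℝ) ≤ 2 * Real.pi := by positivity
  -- Averaging over the rotations `u ↦ e^{iθ} u`: inside, the one-variable mean value property gives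
  -- `h w`; after Fubini, rotation invariance of the polydisc removes `θ`.
  have e1 : ∫ u in B, ∫ θ in I, h (w + circleMap 0 1 θ • u) = ∫ u in B, (2 * Real.pi) • h w := by
    refine setIntegral_congr_fun measurableSet_closedBall fun u hu => ?_
    have := circleAverage_slice hrR hd hu
    rw [Real.circleAverage, intervalIntegral.integral_of_le h2pi] at this
    rw [← this, smul_inv_smul₀ (by positivity)]
  have e2 : ∫ θ in I, ∫ u in B, h (w + circleMap 0 1 θ • u) = ∫ θ in I, ∫ u in B, h (w + u) := by
    refine integral_congr_ae (Eventually.of_forall fun θ => ?_)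
    have := setIntegral_closedBall_circle_smul (Circle.exp θ) r fun u => h (w + u)
    simpa [circleMap, B] using this
  have hswap := integral_integral_swap
    (f := fun (u : Fin n → ℂ) (θ : ℝ) => h (w + circleMap 0 1 θ • u)) hint
  rw [e1, e2] at hswap
  rw [htr, hvol]
  simp only [integral_const, measureReal_restrict_apply_univ, I] at hswap
  rw [Real.volume_real_Ioc_of_le h2pi, sub_zero, smul_comm] at hswap
  have := smul_right_injective ℂ (by positivity : (2 * Real.pi) ≠ 0) hswap
  rw [← this, Complex.real_smul]
  rfl

end SeveralVariables

/-! ### The Bergman space as a Hilbert space -/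

section BergmanSpace

open Metric Set Filter Topology

variable {n : ℕ} {Ω : Set (Fin n → ℂ)}

/-- The Bergman space `A²(Ω)` as a subspace of `L²(Ω)`. -/
def bergmanSubmodule (Ω : Set (Fin n → ℂ)) : Submodule ℂ (Lp ℂ 2 (volume.restrict Ω)) where
  carrier := {F | ∃ h : (Fin n → ℂ) → ℂ, DifferentiableOn ℂ h Ω ∧ F =ᵐ[volume.restrict Ω] h}
  add_mem' := by
    rintro F G ⟨h, hd, hF⟩ ⟨k, kd, hG⟩
    exact ⟨h + k, hd.add kd, (Lp.coeFn_add F G).trans (hF.add hG)⟩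
  zero_mem' := ⟨0, differentiableOn_const 0, Lp.coeFn_zero _ _ _⟩
  smul_mem' := by
    rintro c F ⟨h, hd, hF⟩
    exact ⟨c • h, hd.const_smul c, (Lp.coeFn_smul c F).trans (hF.const_smul c)⟩

/-- The holomorphic representative of an element of the Bergman space. -/
def bergmanRep (F : bergmanSubmodule Ω) : (Fin n → ℂ) → ℂ := F.2.choose

theorem differentiableOn_bergmanRep (F : bergmanSubmodule Ω) :
    DifferentiableOn ℂ (bergmanRep F) Ω := F.2.choose_spec.1

theorem ae_eq_bergmanRep (F : bergmanSubmodule Ω) :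
    (F : Lp ℂ 2 (volume.restrict Ω)) =ᵐ[volume.restrict Ω] bergmanRep F := F.2.choose_spec.2

theorem memBergmanSpace_bergmanRep (F : bergmanSubmodule Ω) :
    MemBergmanSpace Ω (bergmanRep F) :=
  ⟨differentiableOn_bergmanRep F, (Lp.memLp _).ae_eq (ae_eq_bergmanRep F)⟩

theorem bergmanRep_eqOn (hΩ : IsOpen Ω) {F : bergmanSubmodule Ω} {h : (Fin n → ℂ) → ℂ}
    (hc : ContinuousOn h Ω)
    (he : (F : Lp ℂ 2 (volume.restrict Ω)) =ᵐ[volume.restrict Ω] h) :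
    EqOn (bergmanRep F) h Ω :=
  Measure.eqOn_open_of_ae_eq ((ae_eq_bergmanRep F).symm.trans he) hΩ
    (differentiableOn_bergmanRep F).continuousOn hc

/-- The element of the Bergman space defined by a square integrable holomorphic function. -/
def MemBergmanSpace.toSubmodule {h : (Fin n → ℂ) → ℂ} (hh : MemBergmanSpace Ω h) :
    bergmanSubmodule Ω := ⟨hh.2.toLp h, h, hh.1, hh.2.coeFn_toLp⟩

theorem MemBergmanSpace.coeFn_toSubmodule {h : (Fin n → ℂ) → ℂ} (hh : MemBergmanSpace Ω h) :
    (hh.toSubmodule : Lp ℂ 2 (volume.restrict Ω)) =ᵐ[volume.restrict Ω] h := hh.2.coeFn_toLp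

theorem MemBergmanSpace.bergmanRep_toSubmodule (hΩ : IsOpen Ω) {h : (Fin n → ℂ) → ℂ}
    (hh : MemBergmanSpace Ω h) : EqOn (bergmanRep hh.toSubmodule) h Ω :=
  bergmanRep_eqOn hΩ hh.1.continuousOn hh.coeFn_toSubmodule

theorem inner_bergmanSubmodule (F G : bergmanSubmodule Ω) :
    inner ℂ F G = ∫ ξ in Ω, bergmanRep G ξ * (starRingEnd ℂ) (bergmanRep F ξ) := by
  rw [Submodule.coe_inner, L2.inner_def]
  refine integral_congr_ae ?_
  filter_upwards [ae_eq_bergmanRep F, ae_eq_bergmanRep G] with x hx hy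
  rw [hx, hy, RCLike.inner_apply]

/-- By the mean value property, evaluation at `w` is pairing with a normalized indicator, so
Cauchy–Schwarz applies. The constant depends on `r` only, hence is locally uniform in `w`. -/
theorem norm_bergmanRep_le {r R : ℝ} (hr : 0 < r) (hrR : r < R) {w : Fin n → ℂ}
    (hb : ball w R ⊆ Ω) (F : bergmanSubmodule Ω) :
    ‖bergmanRep F w‖ ≤ (volume (closedBall (0 : Fin n → ℂ) r)).toReal⁻¹ *
      (volume (closedBall (0 : Fin n → ℂ) r)).toReal ^ (1 / (2 : ENNReal).toReal) * ‖F‖ := by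
  have hvol : volume (closedBall w r) = volume (closedBall (0 : Fin n → ℂ) r) := by
    rw [Measure.addHaar_closedBall_center]
  have hsub : closedBall w r ⊆ Ω := (closedBall_subset_ball hrR).trans hb
  have hres : (volume.restrict Ω) (closedBall w r) = volume (closedBall w r) := by
    rw [Measure.restrict_apply measurableSet_closedBall, inter_eq_left.2 hsub]
  have hfin : (volume.restrict Ω) (closedBall w r) ≠ ⊤ := by
    rw [hres]; exact measure_closedBall_lt_top.ne
  have hpos : 0 < (volume (closedBall (0 : Fin n → ℂ) r)).toReal :=
    ENNReal.toReal_pos (measure_closedBall_pos _ _ hr).ne' measure_closedBall_lt_top.ne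
  have hmean := setIntegral_closedBall_eq_of_differentiableOn hrR
    ((differentiableOn_bergmanRep F).mono hb)
  have hinner := L2.inner_indicatorConstLp_one (𝕜 := ℂ) measurableSet_closedBall hfin
    (F : Lp ℂ 2 (volume.restrict Ω))
  rw [integral_congr_ae (ae_restrict_of_ae (ae_eq_bergmanRep F)),
    Measure.restrict_restrict measurableSet_closedBall, inter_eq_left.2 hsub, hmean, hvol] at hinner
  have hle := norm_inner_le_norm (𝕜 := ℂ)
    (indicatorConstLp 2 measurableSet_closedBall hfin (1 : ℂ)) (F : Lp ℂ 2 (volume.restrict Ω))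
  rw [hinner, norm_indicatorConstLp two_ne_zero ENNReal.ofNat_ne_top, norm_one, one_mul,
    measureReal_def, hres, hvol, norm_mul, Complex.norm_real,
    Real.norm_of_nonneg hpos.le] at hle
  rw [mul_assoc, ← div_eq_inv_mul, le_div_iff₀ hpos, mul_comm]
  exact hle

open Classical in
/-- Evaluation at `w ∈ Ω` as a bounded functional on the Bergman space. -/
def bergmanEval (Ω : Set (Fin n → ℂ)) (w : Fin n → ℂ) : bergmanSubmodule Ω →L[ℂ] ℂ :=
  if h : ∃ T : bergmanSubmodule Ω →L[ℂ] ℂ, ∀ F, T F = bergmanRep F w then h.choose else 0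

theorem bergmanEval_apply (hΩ : IsOpen Ω) {w : Fin n → ℂ} (hw : w ∈ Ω) (F : bergmanSubmodule Ω) :
    bergmanEval Ω w F = bergmanRep F w := by
  have h : ∃ T : bergmanSubmodule Ω →L[ℂ] ℂ, ∀ F, T F = bergmanRep F w := by
    obtain ⟨R, hR, hb⟩ := Metric.isOpen_iff.1 hΩ w hw
    exact ⟨LinearMap.mkContinuous
      { toFun := fun F => bergmanRep F w
        map_add' := fun F G => bergmanRep_eqOn hΩ (h := bergmanRep F + bergmanRep G)
          ((differentiableOn_bergmanRep F).add (differentiableOn_bergmanRep G)).continuousOn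
          ((Lp.coeFn_add _ _).trans ((ae_eq_bergmanRep F).add (ae_eq_bergmanRep G))) hw
        map_smul' := fun c F => bergmanRep_eqOn hΩ (h := c • bergmanRep F)
          ((differentiableOn_bergmanRep F).const_smul c).continuousOn
          ((Lp.coeFn_smul _ _).trans ((ae_eq_bergmanRep F).const_smul c)) hw }
      _ (norm_bergmanRep_le (half_pos hR) (half_lt_self hR) hb), fun F => rfl⟩
  rw [bergmanEval, dif_pos h, h.choose_spec]

theorem differentiableOn_bergmanEval (hΩ : IsOpen Ω) :
    DifferentiableOn ℂ (bergmanEval Ω) Ω := by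
  refine differentiableOn_of_forall_apply (fun F => ?_) fun w hw => ?_
  · exact (differentiableOn_bergmanRep F).congr fun y hy => bergmanEval_apply hΩ hy F
  · obtain ⟨R, hR, hb⟩ := Metric.isOpen_iff.1 hΩ w hw
    refine ⟨R / 2, half_pos hR, (volume (closedBall (0 : Fin n → ℂ) (R / 4))).toReal⁻¹ *
      (volume (closedBall (0 : Fin n → ℂ) (R / 4))).toReal ^ (1 / (2 : ENNReal).toReal),
      (ball_subset_ball (half_le_self hR.le)).trans hb,
      fun y hy => ContinuousLinearMap.opNorm_le_bound _ (by positivity) fun F => ?_⟩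
    rw [bergmanEval_apply hΩ (hb (ball_subset_ball (half_le_self hR.le) hy))]
    refine norm_bergmanRep_le (r := R / 4) (R := R / 2) (by positivity) (by linarith)
      (fun x hx => hb ?_) F
    rw [mem_ball] at *
    linarith [dist_triangle x y w]

/-- The limit lives in the bidual, so no completeness of `S` is needed; this avoids circularity in
proving the Bergman space closed. -/
theorem exists_tendsto_apply_of_cauchySeq {𝕜 S : Type*} [RCLike 𝕜] [NormedAddCommGroup S]
    [NormedSpace 𝕜 S] {t : ℕ → S} (ht : CauchySeq t) :
    ∃ Λ : (S →L[𝕜] 𝕜) →L[𝕜] 𝕜, ∀ T : S →L[𝕜] 𝕜,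
      Tendsto (fun k => T (t k)) atTop (𝓝 (Λ T)) := by
  obtain ⟨Λ, hΛ⟩ := cauchySeq_tendsto_of_complete
    ((NormedSpace.inclusionInDoubleDualLi 𝕜 (E := S)).lipschitz.cauchySeq_comp ht)
  exact ⟨Λ, fun T => ((ContinuousLinearMap.apply 𝕜 𝕜 T).continuous.tendsto Λ).comp hΛ⟩

/-- The bidual limit `Λ` composed with the norm-holomorphic evaluation map is a holomorphic
function, and an almost everywhere convergent subsequence identifies it with the `L²` limit. -/
theorem isClosed_bergmanSubmodule (hΩ : IsOpen Ω) :
    IsClosed (bergmanSubmodule Ω : Set (Lp ℂ 2 (volume.restrict Ω))) := by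
  refine IsSeqClosed.isClosed ?_
  intro s F hs hF
  let t : ℕ → bergmanSubmodule Ω := fun k => ⟨s k, hs k⟩
  have ht : CauchySeq t := by
    have := hF.cauchySeq
    rw [Metric.cauchySeq_iff] at this ⊢
    exact this
  obtain ⟨Λ, hΛ⟩ := exists_tendsto_apply_of_cauchySeq (𝕜 := ℂ) ht
  refine ⟨fun y => Λ (bergmanEval Ω y),
    Λ.differentiable.comp_differentiableOn (differentiableOn_bergmanEval hΩ), ?_⟩
  obtain ⟨φ, hφ, hae⟩ := (tendstoInMeasure_of_tendsto_Lp hF).exists_seq_tendsto_ae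
  have hall : ∀ᵐ x ∂(volume.restrict Ω), ∀ k, s k x = bergmanRep (t k) x :=
    ae_all_iff.2 fun k => ae_eq_bergmanRep (t k)
  filter_upwards [hae, hall, ae_restrict_mem hΩ.measurableSet] with x hx hxs hxΩ
  refine tendsto_nhds_unique hx ?_
  have h1 : Tendsto (fun k => bergmanEval Ω x (t (φ k))) atTop (𝓝 (Λ (bergmanEval Ω x))) :=
    (hΛ (bergmanEval Ω x)).comp hφ.tendsto_atTop
  refine h1.congr fun k => ?_
  rw [bergmanEval_apply hΩ hxΩ, hxs]

open Classical in
/-- The Riesz representative of the functional `T`. -/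
def bergmanVector (Ω : Set (Fin n → ℂ)) (T : bergmanSubmodule Ω →L[ℂ] ℂ) : bergmanSubmodule Ω :=
  if h : ∃ k : bergmanSubmodule Ω, ∀ F, inner ℂ k F = T F then h.choose else 0

theorem inner_bergmanVector (hΩ : IsOpen Ω) (T : bergmanSubmodule Ω →L[ℂ] ℂ)
    (F : bergmanSubmodule Ω) : inner ℂ (bergmanVector Ω T) F = T F := by
  have : CompleteSpace (bergmanSubmodule Ω) := (isClosed_bergmanSubmodule hΩ).completeSpace_coe
  have h : ∃ k : bergmanSubmodule Ω, ∀ F, inner ℂ k F = T F :=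
    ⟨(InnerProductSpace.toDual ℂ _).symm T, fun F => InnerProductSpace.toDual_symm_apply⟩
  rw [bergmanVector, dif_pos h, h.choose_spec]

theorem bergmanKernel_eqOn (hΩ : IsOpen Ω) {z w : Fin n → ℂ} (hz : z ∈ Ω) (hw : w ∈ Ω) :
    bergmanKernel Ω z w = bergmanRep (bergmanVector Ω (bergmanEval Ω w)) z := by
  have h : ∃ k, IsReproducingAt Ω w k := by
    refine ⟨_, memBergmanSpace_bergmanRep (bergmanVector Ω (bergmanEval Ω w)), fun h hh => ?_⟩
    rw [← hh.bergmanRep_toSubmodule hΩ hw, ← bergmanEval_apply hΩ hw, ← inner_bergmanVector hΩ,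
      inner_bergmanSubmodule]
    refine setIntegral_congr_fun hΩ.measurableSet fun x hx => ?_
    simp only [hh.bergmanRep_toSubmodule hΩ hx]
  rw [bergmanKernel, dif_pos h]
  obtain ⟨hk, hr⟩ := h.choose_spec
  have : hk.toSubmodule = bergmanVector Ω (bergmanEval Ω w) := by
    refine ext_inner_right ℂ fun F => ?_
    rw [inner_bergmanVector hΩ, bergmanEval_apply hΩ hw, hr _ (memBergmanSpace_bergmanRep F),
      inner_bergmanSubmodule]
    refine setIntegral_congr_fun hΩ.measurableSet fun x hx => ?_
    simp only [hk.bergmanRep_toSubmodule hΩ hx]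
  rw [← this, hk.bergmanRep_toSubmodule hΩ hz]

/-- The kernel as an inner product of representatives. -/
theorem bergmanKernel_eq_inner (hΩ : IsOpen Ω) {z w : Fin n → ℂ} (hz : z ∈ Ω) (hw : w ∈ Ω) :
    bergmanKernel Ω z w =
      inner ℂ (bergmanVector Ω (bergmanEval Ω z)) (bergmanVector Ω (bergmanEval Ω w)) := by
  rw [bergmanKernel_eqOn hΩ hz hw, inner_bergmanVector hΩ, bergmanEval_apply hΩ hz]

theorem MemBergmanSpace.of_differentiable (hΩ : IsOpen Ω) (hb : Bornology.IsBounded Ω)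
    {h : (Fin n → ℂ) → ℂ} (hd : Differentiable ℂ h) : MemBergmanSpace Ω h := by
  refine ⟨hd.differentiableOn, ?_⟩
  have hcomp : IsCompact (closure Ω) := hb.isCompact_closure
  obtain ⟨C, hC⟩ := hcomp.exists_bound_of_continuousOn hd.continuous.continuousOn
  have : IsFiniteMeasure (volume.restrict Ω) := ⟨by
    rw [Measure.restrict_apply_univ]
    exact (measure_mono subset_closure).trans_lt hcomp.measure_lt_top⟩
  refine MemLp.of_bound hd.continuous.aestronglyMeasurable C ?_
  filter_upwards [ae_restrict_mem hΩ.measurableSet] with x hx using hC x (subset_closure hx)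

theorem bergmanVector_eval_ne_zero (hΩ : IsOpen Ω) (hb : Bornology.IsBounded Ω) {w : Fin n → ℂ}
    (hw : w ∈ Ω) : bergmanVector Ω (bergmanEval Ω w) ≠ 0 := by
  intro h0
  have h1 : MemBergmanSpace Ω fun _ => 1 := .of_differentiable hΩ hb (differentiable_const 1)
  have := inner_bergmanVector hΩ (bergmanEval Ω w) h1.toSubmodule
  rw [h0, inner_zero_left, bergmanEval_apply hΩ hw, h1.bergmanRep_toSubmodule hΩ hw] at this
  exact zero_ne_one this

/-- The points of a bounded domain are separated by the Bergman space, even projectively. -/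
theorem eq_of_bergmanVector_eq_smul (hΩ : IsOpen Ω) (hb : Bornology.IsBounded Ω)
    {x y : Fin n → ℂ} (hx : x ∈ Ω) (hy : y ∈ Ω) {c : ℂ}
    (h : bergmanVector Ω (bergmanEval Ω x) = c • bergmanVector Ω (bergmanEval Ω y)) : x = y := by
  have key : ∀ {g : (Fin n → ℂ) → ℂ}, Differentiable ℂ g → g x = (starRingEnd ℂ) c * g y := by
    intro g hg
    have hm : MemBergmanSpace Ω g := .of_differentiable hΩ hb hg
    rw [← hm.bergmanRep_toSubmodule hΩ hx, ← hm.bergmanRep_toSubmodule hΩ hy,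
      ← bergmanEval_apply hΩ hx, ← bergmanEval_apply hΩ hy, ← inner_bergmanVector hΩ,
      ← inner_bergmanVector hΩ, h]
    rw [Submodule.coe_inner, Submodule.coe_smul, inner_smul_left, Submodule.coe_inner]
  -- The constant `1` forces the conjugate of `c` to be `1`; the coordinate functions then give `x =
  -- y`.
  have h1 := key (differentiable_const 1)
  rw [mul_one] at h1
  ext i
  have := key (differentiable_apply (𝕜 := ℂ) i)
  rwa [← h1, one_mul] at this

end BergmanSpace

/-! ### The score of the Poisson-Bergman family -/

section Score

open Metric Set Filter Topology

/-- The Riesz isometry is conjugate linear, hence real linear, and carries the dual norm to a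
Hilbert norm, whose square is real differentiable. -/
theorem differentiableAt_norm_sq_dual {E S : Type*} [NormedAddCommGroup E] [NormedSpace ℂ E]
    [NormedAddCommGroup S] [InnerProductSpace ℂ S] [CompleteSpace S] {T : E → S →L[ℂ] ℂ} {z : E}
    (hT : DifferentiableAt ℂ T z) : DifferentiableAt ℝ (fun y => ‖T y‖ ^ 2) z := by
  let J : (S →L[ℂ] ℂ) →L[ℝ] S := LinearMap.mkContinuous
    { toFun := fun A => (InnerProductSpace.toDual ℂ S).symm A
      map_add' := fun A B => map_add _ A B
      map_smul' := fun r A => by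
        have : r • A = (r : ℂ) • A := by ext; simp
        rw [this, map_smulₛₗ]
        simp }
    1 fun A => by simp
  have hJ : ∀ A, ‖J A‖ = ‖A‖ := fun A => (InnerProductSpace.toDual ℂ S).symm.norm_map A
  have := (J.differentiableAt.comp z (hT.restrictScalars ℝ)).norm_sq ℂ
  simpa only [Function.comp, hJ] using this

variable {n : ℕ} {Ω : Set (Fin n → ℂ)}

theorem norm_bergmanVector (hΩ : IsOpen Ω) (T : bergmanSubmodule Ω →L[ℂ] ℂ) :
    ‖bergmanVector Ω T‖ = ‖T‖ := by
  have : CompleteSpace (bergmanSubmodule Ω) := (isClosed_bergmanSubmodule hΩ).completeSpace_coe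
  have : bergmanVector Ω T = (InnerProductSpace.toDual ℂ _).symm T := ext_inner_right ℂ fun F => by
    rw [inner_bergmanVector hΩ, InnerProductSpace.toDual_symm_apply]
  rw [this, LinearIsometryEquiv.norm_map]

/-- As a function of `ξ` this is the conjugate of an element of `A²`. Taking `T` to be evaluation at
`z` or its derivative gives continuity and square integrability of `K(z, ·)` and `∂_v K(z, ·)`. -/
theorem apply_bergmanVector_eval (hΩ : IsOpen Ω) (T : bergmanSubmodule Ω →L[ℂ] ℂ)
    {ξ : Fin n → ℂ} (hξ : ξ ∈ Ω) :
    T (bergmanVector Ω (bergmanEval Ω ξ)) =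
      (starRingEnd ℂ) (bergmanRep (bergmanVector Ω T) ξ) := by
  rw [← bergmanEval_apply hΩ hξ, ← inner_bergmanVector hΩ, ← inner_bergmanVector hΩ,
    Submodule.coe_inner, Submodule.coe_inner, inner_conj_symm]

/-- The holomorphic function `K(·, ξ)`. -/
def bergmanSection (Ω : Set (Fin n → ℂ)) (ξ : Fin n → ℂ) : (Fin n → ℂ) → ℂ :=
  bergmanRep (bergmanVector Ω (bergmanEval Ω ξ))

theorem differentiableOn_bergmanSection (Ω : Set (Fin n → ℂ)) (ξ : Fin n → ℂ) :
    DifferentiableOn ℂ (bergmanSection Ω ξ) Ω := differentiableOn_bergmanRep _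

theorem bergmanSection_eq (hΩ : IsOpen Ω) {z : Fin n → ℂ} (hz : z ∈ Ω) (ξ : Fin n → ℂ) :
    bergmanSection Ω ξ z = bergmanEval Ω z (bergmanVector Ω (bergmanEval Ω ξ)) :=
  (bergmanEval_apply hΩ hz _).symm

theorem fderiv_bergmanSection (hΩ : IsOpen Ω) {z : Fin n → ℂ} (hz : z ∈ Ω) (ξ v : Fin n → ℂ) :
    fderiv ℂ (bergmanSection Ω ξ) z v =
      fderiv ℂ (bergmanEval Ω) z v (bergmanVector Ω (bergmanEval Ω ξ)) := by
  have h1 : bergmanSection Ω ξ =ᶠ[𝓝 z]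
      fun y => bergmanEval Ω y (bergmanVector Ω (bergmanEval Ω ξ)) := by
    filter_upwards [hΩ.mem_nhds hz] with y hy using bergmanSection_eq hΩ hy ξ
  have hd := ((differentiableOn_bergmanEval hΩ).differentiableAt (hΩ.mem_nhds hz)).hasFDerivAt
  have h2 := hd.clm_apply (hasFDerivAt_const (bergmanVector Ω (bergmanEval Ω ξ)) z)
  rw [h1.fderiv_eq, h2.fderiv]
  simp

theorem continuous_apply_bergmanVector (hΩ : IsOpen Ω) (T : bergmanSubmodule Ω →L[ℂ] ℂ) :
    Continuous fun ξ : Ω => T (bergmanVector Ω (bergmanEval Ω ξ)) := by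
  simp_rw [fun ξ : Ω => apply_bergmanVector_eval hΩ T ξ.2]
  exact Complex.continuous_conj.comp
    (continuousOn_iff_continuous_domRestrict.1 (differentiableOn_bergmanRep _).continuousOn)

theorem integrable_norm_sq_apply_bergmanVector (hΩ : IsOpen Ω) (T : bergmanSubmodule Ω →L[ℂ] ℂ) :
    Integrable (fun ξ : Ω => ‖T (bergmanVector Ω (bergmanEval Ω ξ))‖ ^ 2) := by
  simp_rw [fun ξ : Ω => apply_bergmanVector_eval hΩ T ξ.2, RCLike.norm_conj]
  have h := (memBergmanSpace_bergmanRep (bergmanVector Ω T)).2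
  have h2 := (memLp_two_iff_integrable_sq_norm h.1).1 h
  exact (integrableOn_iff_comap_subtypeVal (μ := volume) hΩ.measurableSet
    (f := fun ξ => ‖bergmanRep (bergmanVector Ω T) ξ‖ ^ 2)).1 h2

theorem continuous_bergmanSection_apply (hΩ : IsOpen Ω) {z : Fin n → ℂ} (hz : z ∈ Ω) :
    Continuous fun ξ : Ω => bergmanSection Ω ξ z := by
  simp_rw [bergmanSection_eq hΩ hz]
  exact continuous_apply_bergmanVector hΩ _

theorem continuous_fderiv_bergmanSection_apply (hΩ : IsOpen Ω) {z : Fin n → ℂ} (hz : z ∈ Ω)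
    (v : Fin n → ℂ) : Continuous fun ξ : Ω => fderiv ℂ (bergmanSection Ω ξ) z v := by
  simp_rw [fun ξ : Ω => fderiv_bergmanSection hΩ hz ξ v]
  exact continuous_apply_bergmanVector hΩ _

theorem integrable_norm_sq_bergmanSection (hΩ : IsOpen Ω) {z : Fin n → ℂ} (hz : z ∈ Ω) :
    Integrable (fun ξ : Ω => ‖bergmanSection Ω ξ z‖ ^ 2) := by
  simp_rw [bergmanSection_eq hΩ hz]
  exact integrable_norm_sq_apply_bergmanVector hΩ _

theorem integrable_norm_sq_fderiv_bergmanSection (hΩ : IsOpen Ω) {z : Fin n → ℂ} (hz : z ∈ Ω)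
    (v : Fin n → ℂ) : Integrable (fun ξ : Ω => ‖fderiv ℂ (bergmanSection Ω ξ) z v‖ ^ 2) := by
  simp_rw [fun ξ : Ω => fderiv_bergmanSection hΩ hz ξ v]
  exact integrable_norm_sq_apply_bergmanVector hΩ _

theorem bergmanKernel_self_re (hΩ : IsOpen Ω) {z : Fin n → ℂ} (hz : z ∈ Ω) :
    (bergmanKernel Ω z z).re = ‖bergmanEval Ω z‖ ^ 2 := by
  rw [bergmanKernel_eq_inner hΩ hz hz, Submodule.coe_inner, inner_self_eq_norm_sq_to_K,
    ← norm_bergmanVector hΩ]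
  norm_cast

theorem poissonBergman_eq (hΩ : IsOpen Ω) {z : Fin n → ℂ} (hz : z ∈ Ω) (ξ : Ω) :
    poissonBergman Ω z ξ = ‖bergmanSection Ω ξ z‖ ^ 2 / ‖bergmanEval Ω z‖ ^ 2 := by
  rw [poissonBergman, bergmanKernel_self_re hΩ hz, bergmanKernel_eqOn hΩ hz ξ.2]
  rfl

theorem norm_bergmanEval_pos (hΩ : IsOpen Ω) (hb : Bornology.IsBounded Ω) {z : Fin n → ℂ}
    (hz : z ∈ Ω) : 0 < ‖bergmanEval Ω z‖ := by
  rw [← norm_bergmanVector hΩ]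
  exact norm_pos_iff.2 (bergmanVector_eval_ne_zero hΩ hb hz)

/-- The logarithmic derivative `∂_v log P(z, ξ)`. -/
def bergmanScore (Ω : Set (Fin n → ℂ)) (z v : Fin n → ℂ) (ξ : Ω) : ℝ :=
  2 * inner ℝ (bergmanSection Ω ξ z) (fderiv ℂ (bergmanSection Ω ξ) z v) /
      ‖bergmanSection Ω ξ z‖ ^ 2 -
    fderiv ℝ (fun y => ‖bergmanEval Ω y‖ ^ 2) z v / ‖bergmanEval Ω z‖ ^ 2

theorem measurable_bergmanScore (hΩ : IsOpen Ω) {z : Fin n → ℂ} (hz : z ∈ Ω) (v : Fin n → ℂ) :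
    Measurable (bergmanScore Ω z v) := by
  have h1 := continuous_bergmanSection_apply hΩ hz
  have h2 := continuous_fderiv_bergmanSection_apply hΩ hz v
  exact (((h1.inner h2).measurable.const_mul 2).div (h1.norm.pow 2).measurable).sub_const _

theorem fderiv_poissonBergman (hΩ : IsOpen Ω) (hb : Bornology.IsBounded Ω) {z : Fin n → ℂ}
    (hz : z ∈ Ω) (v : Fin n → ℂ) (ξ : Ω) :
    fderiv ℝ (fun y => poissonBergman Ω y ξ) z v =
      poissonBergman Ω z ξ * bergmanScore Ω z v ξ := by
  have : CompleteSpace (bergmanSubmodule Ω) := (isClosed_bergmanSubmodule hΩ).completeSpace_coe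
  have hpos := norm_bergmanEval_pos hΩ hb hz
  have hev : (fun y => poissonBergman Ω y ξ) =ᶠ[𝓝 z]
      fun y => ‖bergmanSection Ω ξ y‖ ^ 2 * (‖bergmanEval Ω y‖ ^ 2)⁻¹ := by
    filter_upwards [hΩ.mem_nhds hz] with y hy
    rw [poissonBergman_eq hΩ hy ξ, div_eq_mul_inv]
  have h1 := (((differentiableOn_bergmanSection Ω ξ).differentiableAt
    (hΩ.mem_nhds hz)).hasFDerivAt.restrictScalars ℝ).norm_sq
  have h2 : DifferentiableAt ℝ (fun y => ‖bergmanEval Ω y‖ ^ 2) z :=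
    differentiableAt_norm_sq_dual ((differentiableOn_bergmanEval hΩ).differentiableAt
      (hΩ.mem_nhds hz))
  have h3 := h1.mul ((hasDerivAt_inv (pow_ne_zero 2 hpos.ne')).comp_hasFDerivAt z h2.hasFDerivAt)
  rw [(HasFDerivAt.congr_of_eventuallyEq h3 hev).fderiv, poissonBergman_eq hΩ hz, bergmanScore]
  -- At a zero of `K(z, ξ)` both `P` and its derivative vanish, so the junk value of the score is
  -- harmless.
  by_cases h0 : bergmanSection Ω ξ z = 0
  · simp [h0]
  have h0' : ‖bergmanSection Ω ξ z‖ ≠ 0 := norm_ne_zero_iff.2 h0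
  have := hpos.ne'
  simp
  field_simp
  ring

theorem integrable_poissonBergman (hΩ : IsOpen Ω) {z : Fin n → ℂ} (hz : z ∈ Ω) :
    Integrable (poissonBergman Ω z) := by
  have : poissonBergman Ω z =
      fun ξ : Ω => ‖bergmanSection Ω ξ z‖ ^ 2 / ‖bergmanEval Ω z‖ ^ 2 :=
    funext fun ξ => poissonBergman_eq hΩ hz ξ
  rw [this]
  exact (integrable_norm_sq_bergmanSection hΩ hz).div_const _

theorem poissonBergman_nonneg (hΩ : IsOpen Ω) {z : Fin n → ℂ} (hz : z ∈ Ω) (ξ : Ω) :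
    0 ≤ poissonBergman Ω z ξ := by
  rw [poissonBergman_eq hΩ hz]
  positivity

theorem measurable_poissonBergman (hΩ : IsOpen Ω) {z : Fin n → ℂ} (hz : z ∈ Ω) :
    Measurable (poissonBergman Ω z) := by
  have : poissonBergman Ω z =
      fun ξ : Ω => ‖bergmanSection Ω ξ z‖ ^ 2 / ‖bergmanEval Ω z‖ ^ 2 :=
    funext fun ξ => poissonBergman_eq hΩ hz ξ
  rw [this]
  exact ((continuous_bergmanSection_apply hΩ hz).norm.pow 2).measurable.div_const _

theorem isFiniteMeasure_densityMeasure_poissonBergman (hΩ : IsOpen Ω) {z : Fin n → ℂ}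
    (hz : z ∈ Ω) : IsFiniteMeasure (densityMeasure (poissonBergman Ω) z) :=
  isFiniteMeasure_withDensity_ofReal (integrable_poissonBergman hΩ hz).2

theorem memLp_bergmanScore (hΩ : IsOpen Ω) {z : Fin n → ℂ} (hz : z ∈ Ω) (v : Fin n → ℂ) :
    MemLp (bergmanScore Ω z v) 2 (densityMeasure (poissonBergman Ω) z) := by
  have hm := measurable_bergmanScore hΩ hz v
  rw [memLp_two_iff_integrable_sq hm.aestronglyMeasurable, densityMeasure,
    integrable_withDensity_iff (measurable_poissonBergman hΩ hz).ennreal_ofReal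
      (Eventually.of_forall fun _ => ENNReal.ofReal_lt_top)]
  set c := ‖bergmanEval Ω z‖ ^ 2 with hc
  set d := fderiv ℝ (fun y => ‖bergmanEval Ω y‖ ^ 2) z v
  refine Integrable.mono' (((integrable_norm_sq_fderiv_bergmanSection hΩ hz v).const_mul
    (8 / c)).add ((integrable_norm_sq_bergmanSection hΩ hz).const_mul (2 * (d / c) ^ 2 / c)))
    (((hm.pow_const 2).mul
      (measurable_poissonBergman hΩ hz).ennreal_ofReal.ennreal_toReal).aestronglyMeasurable)
    (Eventually.of_forall fun ξ => ?_)
  have hP := poissonBergman_nonneg hΩ hz ξ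
  rw [ENNReal.toReal_ofReal hP, Real.norm_of_nonneg (mul_nonneg (sq_nonneg _) hP),
    poissonBergman_eq hΩ hz]
  simp only [Pi.add_apply, bergmanScore]
  have hc0 : 0 ≤ c := by positivity
  set a := bergmanSection Ω ξ z
  set b := fderiv ℂ (bergmanSection Ω ξ) z v
  -- Cauchy–Schwarz cancels the singularity of the score at the zeros of the kernel against the
  -- density.
  have hs : (2 * inner ℝ a b / ‖a‖ ^ 2) ^ 2 * ‖a‖ ^ 2 ≤ 4 * ‖b‖ ^ 2 := by
    by_cases h0 : a = 0
    · simp [h0]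
    have h0' : 0 < ‖a‖ := norm_pos_iff.2 h0
    have hcs : (inner ℝ a b) ^ 2 ≤ (‖a‖ * ‖b‖) ^ 2 :=
      sq_le_sq' (neg_le_of_abs_le (abs_real_inner_le_norm a b)) (real_inner_le_norm a b)
    have : (2 * inner ℝ a b / ‖a‖ ^ 2) ^ 2 * ‖a‖ ^ 2 = 4 * (inner ℝ a b) ^ 2 / ‖a‖ ^ 2 := by
      field_simp
      ring
    rw [this, div_le_iff₀ (by positivity)]
    nlinarith
  have hsq : ∀ s t : ℝ, (s - t) ^ 2 ≤ 2 * s ^ 2 + 2 * t ^ 2 := fun s t => by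
    nlinarith [sq_nonneg (s + t)]
  calc _ = (2 * inner ℝ a b / ‖a‖ ^ 2 - d / c) ^ 2 * ‖a‖ ^ 2 / c := by rw [← hc]; ring
    _ ≤ (2 * (2 * inner ℝ a b / ‖a‖ ^ 2) ^ 2 + 2 * (d / c) ^ 2) * ‖a‖ ^ 2 / c := by
      gcongr
      exact hsq _ _
    _ = (2 * ((2 * inner ℝ a b / ‖a‖ ^ 2) ^ 2 * ‖a‖ ^ 2) + 2 * (d / c) ^ 2 * ‖a‖ ^ 2) / c := by
      ring
    _ ≤ (2 * (4 * ‖b‖ ^ 2) + 2 * (d / c) ^ 2 * ‖a‖ ^ 2) / c := by gcongr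
    _ = _ := by ring

theorem densityTangent_poissonBergman (hΩ : IsOpen Ω) (hb : Bornology.IsBounded Ω)
    {z : Fin n → ℂ} (hz : z ∈ Ω) (v : Fin n → ℂ) :
    densityTangent (poissonBergman Ω) z v =
      (densityMeasure (poissonBergman Ω) z).withDensityᵥ (bergmanScore Ω z v) := by
  have := isFiniteMeasure_densityMeasure_poissonBergman hΩ hz
  have hmP := (measurable_poissonBergman hΩ hz).ennreal_ofReal
  have hlt : ∀ᵐ ξ : Ω, ENNReal.ofReal (poissonBergman Ω z ξ) < ⊤ :=
    Eventually.of_forall fun _ => ENNReal.ofReal_lt_top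
  have hint := (memLp_bergmanScore hΩ hz v).integrable one_le_two
  rw [densityMeasure, integrable_withDensity_iff_integrable_smul' hmP hlt] at hint
  rw [densityTangent, densityMeasure,
    ← withDensityᵥ_smul_eq_withDensityᵥ_withDensity' hmP.aemeasurable hlt hint]
  congr 1
  ext ξ
  rw [fderiv_poissonBergman hΩ hb hz, ENNReal.toReal_ofReal (poissonBergman_nonneg hΩ hz ξ),
    smul_eq_mul]

/-- A statistic is sufficient for the Poisson-Bergman family if and only if all scores factor
through it. -/
theorem isSufficient_poissonBergman_iff {Y : Type*} [MeasurableSpace Y] (hΩ : IsOpen Ω)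
    (hb : Bornology.IsBounded Ω) {f : Ω → Y} (hf : Measurable f) :
    IsSufficient f Ω (poissonBergman Ω) ↔ ∀ z ∈ Ω, ∀ v, ∃ G : Y → ℝ, Measurable G ∧
      bergmanScore Ω z v =ᵐ[densityMeasure (poissonBergman Ω) z] G ∘ f := by
  have key : ∀ z ∈ Ω, ∀ v, (fisherMetric ((densityMeasure (poissonBergman Ω) z).map f)
      ((densityTangent (poissonBergman Ω) z v).map f)
      ((densityTangent (poissonBergman Ω) z v).map f) =
      fisherMetric (densityMeasure (poissonBergman Ω) z) (densityTangent (poissonBergman Ω) z v)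
        (densityTangent (poissonBergman Ω) z v) ↔ ∃ G : Y → ℝ, Measurable G ∧
      bergmanScore Ω z v =ᵐ[densityMeasure (poissonBergman Ω) z] G ∘ f) := by
    intro z hz v
    have := isFiniteMeasure_densityMeasure_poissonBergman hΩ hz
    rw [densityTangent_poissonBergman hΩ hb hz]
    exact fisherMetric_map_eq_iff hf (memLp_bergmanScore hΩ hz v)
  constructor
  · exact fun h z hz v => (key z hz v).1 (h _ ⟨z, hz, rfl⟩ _ ⟨z, hz, rfl, v, rfl⟩)
  · rintro h _ - _ ⟨z, hz, rfl, v, rfl⟩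
    exact (key z hz v).2 (h z hz v)

end Score

/-! ### Sufficient statistics are injective off a null set -/

section Injective

open Metric Set Filter Topology

theorem exists_eq_smul_of_re_logDeriv_eq {E : Type*} [NormedAddCommGroup E] [NormedSpace ℂ E]
    {g h : E → ℂ} {Ω W : Set E} (hΩ : IsOpen Ω) (hΩc : IsPreconnected Ω)
    (hg : DifferentiableOn ℂ g Ω) (hh : DifferentiableOn ℂ h Ω) (hW : IsOpen W) (hWΩ : W ⊆ Ω)
    (hWne : W.Nonempty) (hgW : ∀ z ∈ W, g z ≠ 0) (hhW : ∀ z ∈ W, h z ≠ 0)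
    (he : ∀ z ∈ W, ∀ v, (fderiv ℂ g z v / g z).re = (fderiv ℂ h z v / h z).re) :
    ∃ c : ℂ, ∀ z ∈ Ω, g z = c * h z := by
  have hlog : ∀ z ∈ W, ∀ v, fderiv ℂ g z v / g z = fderiv ℂ h z v / h z := by
    intro z hz v
    refine Complex.ext (he z hz v) ?_
    -- Complex linearity in `v`: the real part at `iv` is minus the imaginary part at `v`.
    have := he z hz (Complex.I • v)
    simpa [mul_div_assoc, Complex.mul_re] using this
  obtain ⟨w, hw⟩ := hWne
  obtain ⟨R, hR, hb⟩ := Metric.isOpen_iff.1 hW w hw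
  have hd : ∀ z ∈ ball w R, HasFDerivAt (fun y => g y * (h y)⁻¹) (0 : E →L[ℂ] ℂ) z := by
    intro z hz
    have hzΩ := hΩ.mem_nhds (hWΩ (hb hz))
    have h1 := (hg.differentiableAt hzΩ).hasFDerivAt
    have h2 := (hh.differentiableAt hzΩ).hasFDerivAt
    have h3 := h1.mul ((hasDerivAt_inv (hhW z (hb hz))).comp_hasFDerivAt z h2)
    refine HasFDerivAt.congr_fderiv h3 ?_
    ext v
    have hl := hlog z (hb hz) v
    have hg0 := hgW z (hb hz)
    have hh0 := hhW z (hb hz)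
    rw [div_eq_div_iff hg0 hh0] at hl
    simp
    field_simp
    linear_combination hl
  obtain ⟨c, hc⟩ := isOpen_ball.exists_is_const_of_fderiv_eq_zero
    (convex_ball w R).isPreconnected
    (fun z hz => (hd z hz).differentiableAt.differentiableWithinAt) fun z hz => (hd z hz).fderiv
  refine ⟨c, fun z hz => ?_⟩
  have hzero := DifferentiableOn.eqOn_zero_of_eventually_eq_zero (h := fun y => g y - c * h y) hΩ
    hΩc (hg.sub (hh.const_mul c)) (hWΩ hw) (by
      filter_upwards [ball_mem_nhds w hR] with y hy
      rw [← hc y hy, inv_mul_cancel_right₀ (hhW y (hb hy)), sub_self]) z hz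
  exact sub_eq_zero.1 hzero

variable {n : ℕ} {Ω : Set (Fin n → ℂ)}

theorem bergmanSection_self_ne_zero (hΩ : IsOpen Ω) (hb : Bornology.IsBounded Ω)
    {x : Fin n → ℂ} (hx : x ∈ Ω) : bergmanSection Ω x x ≠ 0 := by
  intro h0
  rw [bergmanSection_eq hΩ hx, ← inner_bergmanVector hΩ, Submodule.coe_inner,
    inner_self_eq_zero] at h0
  exact bergmanVector_eval_ne_zero hΩ hb hx (Subtype.ext h0)

theorem eq_of_bergmanSection_eq_mul (hΩ : IsOpen Ω) (hb : Bornology.IsBounded Ω)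
    {x y : Fin n → ℂ} (hx : x ∈ Ω) (hy : y ∈ Ω) {c : ℂ}
    (h : ∀ z ∈ Ω, bergmanSection Ω x z = c * bergmanSection Ω y z) : x = y := by
  refine eq_of_bergmanVector_eq_smul hΩ hb hx hy (c := c) (Subtype.ext (Lp.ext ?_))
  rw [Submodule.coe_smul]
  filter_upwards [ae_eq_bergmanRep (bergmanVector Ω (bergmanEval Ω x)),
    ae_eq_bergmanRep (bergmanVector Ω (bergmanEval Ω y)), Lp.coeFn_smul c
      (bergmanVector Ω (bergmanEval Ω y) : Lp ℂ 2 (volume.restrict Ω)),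
    ae_restrict_mem hΩ.measurableSet] with z h1 h2 h3 hz
  rw [h3, h1, Pi.smul_apply, h2, smul_eq_mul]
  exact h z hz

theorem inner_div_norm_sq (a b : ℂ) : inner ℝ a b / ‖a‖ ^ 2 = (b / a).re := by
  rw [Complex.inner, Complex.div_re, ← Complex.normSq_eq_norm_sq]
  simp
  ring

/-- Joint continuity in point and direction lets a countable dense set of pairs determine all
logarithmic derivatives. -/
theorem continuousOn_re_logDeriv {g : (Fin n → ℂ) → ℂ} {W : Set (Fin n → ℂ)} (hΩ : IsOpen Ω)
    (hg : DifferentiableOn ℂ g Ω) (hWΩ : W ⊆ Ω) (hgW : ∀ z ∈ W, g z ≠ 0) :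
    ContinuousOn (fun p : (Fin n → ℂ) × (Fin n → ℂ) => (fderiv ℂ g p.1 p.2 / g p.1).re)
      (W ×ˢ univ) := by
  have h1 : ContinuousOn (fun p : (Fin n → ℂ) × (Fin n → ℂ) => g p.1) (W ×ˢ univ) :=
    (hg.continuousOn.mono hWΩ).comp continuousOn_fst fun p hp => hp.1
  have h2 : ContinuousOn (fun p : (Fin n → ℂ) × (Fin n → ℂ) => fderiv ℂ g p.1) (W ×ˢ univ) :=
    ((hg.continuousOn_fderiv_of_complex hΩ).mono hWΩ).comp continuousOn_fst fun p hp => hp.1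
  exact Complex.continuous_re.comp_continuousOn
    ((h2.clm_apply continuousOn_snd).div h1 fun p hp => hgW _ hp.1)

/-- Points of a bounded domain are separated by the scores, evaluated on a dense set of
parameters and directions. -/
theorem eq_of_bergmanScore_eq (hΩ : IsOpen Ω) (hΩc : IsPreconnected Ω)
    (hb : Bornology.IsBounded Ω) {x y : Ω} {Q : Set ((Fin n → ℂ) × (Fin n → ℂ))} (hQ : Dense Q)
    (h : ∀ q ∈ Q, q.1 ∈ Ω → bergmanSection Ω x q.1 ≠ 0 → bergmanSection Ω y q.1 ≠ 0 →
      bergmanScore Ω q.1 q.2 x = bergmanScore Ω q.1 q.2 y) : x = y := by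
  have hdx := differentiableOn_bergmanSection Ω x
  have hdy := differentiableOn_bergmanSection Ω y
  have hxx := bergmanSection_self_ne_zero hΩ hb x.2
  have hyy := bergmanSection_self_ne_zero hΩ hb y.2
  let W : Set (Fin n → ℂ) :=
    (Ω ∩ bergmanSection Ω x ⁻¹' {0}ᶜ) ∩ (Ω ∩ bergmanSection Ω y ⁻¹' {0}ᶜ)
  have hWo : IsOpen W := (hdx.continuousOn.isOpen_inter_preimage hΩ isOpen_compl_singleton).inter
    (hdy.continuousOn.isOpen_inter_preimage hΩ isOpen_compl_singleton)
  have hWΩ : W ⊆ Ω := fun z hz => hz.1.1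
  -- Otherwise `K(·, y)` vanishes near `x`, where `K(·, x) ≠ 0`, hence everywhere, contradicting
  -- `K(y, y) ≠ 0`.
  have hWne : W.Nonempty := by
    by_contra hne
    refine hyy (hdy.eqOn_zero_of_eventually_eq_zero hΩ hΩc x.2 ?_ y y.2)
    filter_upwards [hΩ.mem_nhds x.2, (hdx.continuousOn.continuousAt
      (hΩ.mem_nhds x.2)).eventually_ne hxx] with z hz hz'
    by_contra hz''
    exact hne ⟨z, ⟨hz, hz'⟩, hz, hz''⟩
  have hEq : EqOn (fun p : (Fin n → ℂ) × (Fin n → ℂ) =>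
      (fderiv ℂ (bergmanSection Ω x) p.1 p.2 / bergmanSection Ω x p.1).re)
      (fun p => (fderiv ℂ (bergmanSection Ω y) p.1 p.2 / bergmanSection Ω y p.1).re)
      (W ×ˢ univ) := by
    have hsub : W ×ˢ univ ⊆ closure ((W ×ˢ univ) ∩ Q) :=
      hQ.open_subset_closure_inter (hWo.prod isOpen_univ)
    refine EqOn.of_subset_closure (s := (W ×ˢ univ) ∩ Q) ?_
      (continuousOn_re_logDeriv hΩ hdx hWΩ fun z hz => hz.1.2)
      (continuousOn_re_logDeriv hΩ hdy hWΩ fun z hz => hz.2.2) inter_subset_left hsub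
    rintro q ⟨hqW, hq⟩
    have := h q hq (hWΩ hqW.1) hqW.1.1.2 hqW.1.2.2
    simp only [bergmanScore, sub_left_inj, mul_div_assoc, inner_div_norm_sq] at this
    exact mul_left_cancel₀ two_ne_zero this
  obtain ⟨c, hc⟩ := exists_eq_smul_of_re_logDeriv_eq hΩ hΩc hdx hdy hWo hWΩ hWne
    (fun z hz => hz.1.2) (fun z hz => hz.2.2) fun z hz v => hEq (x := (z, v)) ⟨hz, mem_univ v⟩
  exact Subtype.ext (eq_of_bergmanSection_eq_mul hΩ hb x.2 y.2 hc)

/-- Any sufficient statistic for the Poisson-Bergman family of a bounded domain is injective off a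
null set. -/
theorem exists_injOn_compl_of_isSufficient {Y : Type*} [MeasurableSpace Y] (hΩ : IsOpen Ω)
    (hΩc : IsPreconnected Ω) (hb : Bornology.IsBounded Ω) {f : Ω → Y} (hf : Measurable f)
    (hs : IsSufficient f Ω (poissonBergman Ω)) :
    ∃ N : Set Ω, volume N = 0 ∧ InjOn f Nᶜ := by
  rw [isSufficient_poissonBergman_iff hΩ hb hf] at hs
  obtain ⟨Q, hQc, hQd⟩ := TopologicalSpace.exists_countable_dense ((Fin n → ℂ) × (Fin n → ℂ))
  choose! G hGm hG using hs
  -- The measure `P dV` ignores the zeros of `K(z, ·)`, hence the nonvanishing condition;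
  -- countability of `Q` merges the exceptional sets into one.
  have hae : ∀ᵐ ξ : Ω, ∀ q ∈ Q, q.1 ∈ Ω → bergmanSection Ω ξ q.1 ≠ 0 →
      bergmanScore Ω q.1 q.2 ξ = G q.1 q.2 (f ξ) := by
    refine (ae_ball_iff hQc).2 fun q _ => ?_
    by_cases hqΩ : q.1 ∈ Ω
    · have h1 := hG q.1 hqΩ q.2
      rw [densityMeasure, EventuallyEq,
        ae_withDensity_iff (measurable_poissonBergman hΩ hqΩ).ennreal_ofReal] at h1
      filter_upwards [h1] with ξ hξ _ hne
      refine hξ ?_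
      rw [Ne, ENNReal.ofReal_eq_zero, not_le, poissonBergman_eq hΩ hqΩ]
      have := norm_bergmanEval_pos hΩ hb hqΩ
      have := norm_pos_iff.2 hne
      positivity
    · exact Eventually.of_forall fun _ hq => absurd hq hqΩ
  refine ⟨_, ae_iff.1 hae, fun x hx y hy hxy => ?_⟩
  simp only [mem_compl_iff, mem_ofPred_eq, not_not] at hx hy
  refine eq_of_bergmanScore_eq hΩ hΩc hb hQd fun q hq hqΩ h1 h2 => ?_
  rw [hx q hq hqΩ h1, hy q hq hqΩ h2, hxy]

theorem isSufficient_of_injOn_compl {Y : Type*} [MeasurableSpace Y]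
    [MeasurableSpace.CountablySeparated Y] (hΩ : IsOpen Ω) (hb : Bornology.IsBounded Ω)
    {f : Ω → Y} (hf : Measurable f) {N : Set Ω} (hN : volume N = 0) (hinj : InjOn f Nᶜ) :
    IsSufficient f Ω (poissonBergman Ω) := by
  rw [isSufficient_poissonBergman_iff hΩ hb hf]
  intro z hz v
  have : StandardBorelSpace Ω := hΩ.measurableSet.standardBorel
  exact exists_measurable_factor_of_injOn hf (withDensity_absolutelyContinuous _ _ hN) hinj
    (measurable_bergmanScore hΩ hz v).aemeasurable

/-- If a sheeted covering off a null set is injective up to a null set, then it has one sheet. -/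
theorem IsSheetedC1CoveringOff.injOn {Ω₁ Ω₂ : Set (Fin n → ℂ)} (hΩ₁ : IsOpen Ω₁)
    {f : Ω₁ → Ω₂} {V : Set Ω₂} {m : ℕ} (hf : IsSheetedC1CoveringOff f V m)
    {N : Set Ω₁} (hN : volume N = 0) (hinj : InjOn f Nᶜ) : InjOn f (f ⁻¹' Vᶜ) := by
  intro x hx y hy hxy
  by_contra hne
  obtain ⟨U, hUo, hζ, -, e, he, hdisj, hpre⟩ := hf (f x) hx
  obtain ⟨j, hj⟩ := (hpre x).1 hζ
  obtain ⟨k, hk⟩ := (hpre y).1 (hxy ▸ hζ)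
  have hjk : j ≠ k := by
    rintro rfl
    refine hne (Subtype.ext ((e j).injOn hj hk ?_))
    rw [← (he j).2.2.2.2 x hj, ← (he j).2.2.2.2 y hk, hxy]
  let N' : Set (Fin n → ℂ) := (↑) '' N
  have hN' : volume N' = 0 := by
    rw [← comap_subtype_coe_apply hΩ₁.measurableSet]
    exact hN
  -- `C¹` maps between spaces of equal dimension preserve null sets, so some `u` in `U` has lifts
  -- outside `N` in both sheets.
  have hnull : ∀ i, volume (e i '' (N' ∩ (e i).source)) = 0 := fun i =>
    addHaar_image_eq_zero_of_differentiableOn_of_addHaar_eq_zero volume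
      (((he i).2.2.1.differentiableOn one_ne_zero).mono inter_subset_right)
      (measure_mono_null inter_subset_left hN')
  have hUpos : volume U ≠ 0 := (hUo.measure_pos volume ⟨_, hζ⟩).ne'
  obtain ⟨u, huU, hu⟩ : ∃ u ∈ U, u ∉ e j '' (N' ∩ (e j).source) ∪ e k '' (N' ∩ (e k).source) := by
    by_contra! hcon
    exact hUpos (measure_mono_null hcon (measure_union_null (hnull j) (hnull k)))
  have hlift : ∀ i, u ∉ e i '' (N' ∩ (e i).source) →
      ∃ a : Ω₁, a ∉ N ∧ (a : Fin n → ℂ) ∈ (e i).source ∧ (f a : Fin n → ℂ) = u := by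
    intro i hi
    have hut : u ∈ (e i).target := by rw [(he i).2.1]; exact huU
    have hs := (e i).map_target hut
    refine ⟨⟨(e i).symm u, (he i).1 hs⟩, fun hmem => hi ?_, hs, ?_⟩
    · exact ⟨(e i).symm u, ⟨⟨_, hmem, rfl⟩, hs⟩, (e i).right_inv hut⟩
    · rw [(he i).2.2.2.2 _ hs]
      exact (e i).right_inv hut
  rw [mem_union, not_or] at hu
  obtain ⟨a, haN, has, hfa⟩ := hlift j hu.1
  obtain ⟨b, hbN, hbs, hfb⟩ := hlift k hu.2
  have hab : a = b := hinj haN hbN (Subtype.ext (hfa.trans hfb.symm))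
  exact (hdisj j k hjk).ne_of_mem has hbs (congrArg _ hab)

/-- Disjoint neighbourhoods of two points with a common image have images meeting in a nonempty open
set; it is not null, so it contains a point off `V` with two preimages. -/
theorem IsOpenMap.injective_of_injOn_preimage_compl {Ω₁ Ω₂ : Set (Fin n → ℂ)}
    (hΩ₂ : IsOpen Ω₂) {f : Ω₁ → Ω₂} (hfo : IsOpenMap f) {V : Set Ω₂} (hV : volume V = 0)
    (hinj : InjOn f (f ⁻¹' Vᶜ)) : Function.Injective f := by
  intro x y hxy
  by_contra hne
  obtain ⟨A, B, hA, hB, hxA, hyB, hAB⟩ := t2_separation hne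
  have hO : IsOpen (f '' A ∩ f '' B) := (hfo A hA).inter (hfo B hB)
  have hO' : IsOpen (((↑) : Ω₂ → Fin n → ℂ) '' (f '' A ∩ f '' B)) :=
    hΩ₂.isOpenMap_subtype_val _ hO
  have hpos : volume (f '' A ∩ f '' B) ≠ 0 := by
    have h0 := (hO'.measure_pos volume
      ⟨_, mem_image_of_mem _ ⟨⟨x, hxA, rfl⟩, ⟨y, hyB, hxy.symm⟩⟩⟩).ne'
    rwa [← comap_subtype_coe_apply hΩ₂.measurableSet] at h0
  have : ¬ f '' A ∩ f '' B ⊆ V := fun hsub => hpos (measure_mono_null hsub hV)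
  obtain ⟨u, ⟨⟨a, ha, hau⟩, ⟨b, hb, hbu⟩⟩, huV⟩ := not_subset.1 this
  have hab : a = b := hinj (by rw [mem_preimage, hau]; exact huV)
    (by rw [mem_preimage, hbu]; exact huV) (hau.trans hbu.symm)
  exact hAB.ne_of_mem ha hb hab

end Injective

end

theorem theoremB {n : ℕ} (Ω₁ Ω₂ : Set (Fin n → ℂ))
    (hΩ₁o : IsOpen Ω₁) (hΩ₁c : IsConnected Ω₁) (hΩ₁b : Bornology.IsBounded Ω₁)
    (hΩ₂o : IsOpen Ω₂) (hΩ₂c : IsConnected Ω₂) (hΩ₂b : Bornology.IsBounded Ω₂)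
    (f : Ω₁ → Ω₂) (hfm : Measurable f) (hfs : Function.Surjective f)
    (m : ℕ) (hm : 0 < m) (V : Set Ω₂) (hV : volume V = 0)
    (hf : IsSheetedC1CoveringOff f V m) :
    ((∃ N : Set Ω₁, volume N = 0 ∧ Set.InjOn f Nᶜ) ↔ IsSufficient f Ω₁ (poissonBergman Ω₁)) ∧
    (IsSufficient f Ω₁ (poissonBergman Ω₁) → Set.InjOn f (f ⁻¹' Vᶜ)) ∧
    (IsOpenMap f → (Function.Injective f ↔ IsSufficient f Ω₁ (poissonBergman Ω₁))) := by
  have hsuff : IsSufficient f Ω₁ (poissonBergman Ω₁) →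
      ∃ N : Set Ω₁, volume N = 0 ∧ Set.InjOn f Nᶜ :=
    exists_injOn_compl_of_isSufficient hΩ₁o hΩ₁c.isPreconnected hΩ₁b hfm
  have hinj : IsSufficient f Ω₁ (poissonBergman Ω₁) → Set.InjOn f (f ⁻¹' Vᶜ) := fun h => by
    obtain ⟨N, hN, hi⟩ := hsuff h
    exact hf.injOn hΩ₁o hN hi
  refine ⟨⟨?_, hsuff⟩, hinj, fun hfo => ⟨fun h => ?_, fun h => ?_⟩⟩
  · rintro ⟨N, hN, hi⟩
    exact isSufficient_of_injOn_compl hΩ₁o hΩ₁b hfm hN hi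
  · exact isSufficient_of_injOn_compl hΩ₁o hΩ₁b hfm (N := ∅) measure_empty h.injOn
  · exact hfo.injective_of_injOn_preimage_compl hΩ₂o hV (hinj h)
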